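/- Let $L$ be a first-order language and let $\mathcal U$ be a saturated $L$-structure whose cardinality $\kappa$ is an uncountable (strongly) inaccessible cardinal larger than $|L|$. Let $A\subseteq\mathcal U$ have cardinality $<\kappa$, let $n<\omega$, and let $\mathcal D\subseteq\mathcal U^{n}$ be arbitrary. Definitions. $\mathrm{Aut}(\mathcal U/A)$ is the group of automorphisms of $\mathcal U$ fixing $A$ pointwise; for a finite tuple $b$ and a set $\mathcal C$ of finite tuples, $o(b/A)=\{f(b): f\in\mathrm{Aut}(\mathcal U/A)\}$ and $o(\mathcal C/A)=\{f[\mathcal C]: f\in\mathrm{Aut}(\mathcal U/A)\}$. The set $\mathcal C$ is invariant over $A$ if $o(\mathcal C/A)=\{\mathcal C\}$, and Lascar invariant over $A$ if it is invariant over every elementary substructure $M\preceq\mathcal U$ with $A\subseteq M$ and $|M|<\kappa$. For $\mathcal C\subseteq\mathcal U^m$, $\langle\mathcal U,\mathcal C\rangle$ is the expansion of $\mathcal U$ by an $m$-ary predicate interpreted as $\mathcal C$, and $e(\mathcal C)$ is the collection of all $\mathcal C'\subseteq\mathcal U^m$ such that $\langle\mathcal U,\mathcal C'\rangle\equiv\langle\mathcal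 U,\mathcal C\rangle$. A family $u$ of subsets of $\mathcal U^m$ locally covers $\mathcal B\subseteq\mathcal U^m$ if for every $\mathcal K\subseteq\mathcal B$ of cardinality $\kappa$ and every $k<\omega$ there is $\mathcal C\in u$ with $k\le|\mathcal K\cap\mathcal C|$. The set $\mathcal C\subseteq\mathcal U^m$ is pseudo-invariant over $A$ if $e(\mathcal C)$ locally covers $o(b/A)$ for every $b\in\mathcal C$. Finally, $L(A;\mathcal D)$ is the set of first-order formulas, with parameters in $A$, in the language of $\langle\mathcal U,\mathcal D\rangle$. Proposition. If $\mathcal D$ is Lascar invariant over $A$, then for every $m<\omega$ and every formula $\varphi(w)\in L(A;\mathcal D)$ with $|w|=m$, the set $\varphi(\mathcal U)\subseteq\mathcal U^m$ is pseudo-invariant over $A$. -/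

import Mathlib

open FirstOrder Cardinal

universe u v w

namespace LascarPseudo

/-- A single relation symbol, of arity `n`. -/
inductive PredRel (n : ℕ) : ℕ → Type
  | mem : PredRel n n

/-- The language whose only symbol is one `n`-ary predicate. -/
def predLang (n : ℕ) : FirstOrder.Language.{0, 0} := ⟨fun _ => Empty, PredRel n⟩

/-- The language `L` together with a new `n`-ary predicate. -/
abbrev expLang (L : FirstOrder.Language.{u, v}) (n : ℕ) : FirstOrder.Language.{u, v} := L.sum (predLang n)

variable {L : FirstOrder.Language.{u, v}} {U : Type w} [L.Structure U]

/-- The interpretation of the new predicate as the set `D`. -/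
@[reducible] def predStructure {n : ℕ} (D : Set (Fin n → U)) : (predLang n).Structure U where
  funMap := fun f _ => Empty.elim f
  RelMap := fun r => match r with
    | PredRel.mem => fun x => x ∈ D

/-- The set `φ(U)` defined by the formula `φ(w) ∈ L(A; D)`, that is, by a formula with parameters
in `A` over the expansion `⟨U, D⟩`. -/
def solutionSet {n m : ℕ} {A : Set U} (D : Set (Fin n → U))
    (φ : (expLang L n)[[A]].Formula (Fin m)) : Set (Fin m → U) :=
  letI : (predLang n).Structure U := predStructure D
  {x | φ.Realize x}

/-- Truth in the expansion `⟨U, D⟩` of a sentence of the expanded language. -/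
def HoldsIn {n : ℕ} (D : Set (Fin n → U)) (φ : (expLang L n).Sentence) : Prop :=
  letI : (predLang n).Structure U := predStructure D
  U ⊨ φ

variable (L)

/-- `e(D)`: the sets `C` such that `⟨U, C⟩` and `⟨U, D⟩` are elementarily equivalent. -/
def eqClass {n : ℕ} (D : Set (Fin n → U)) : Set (Set (Fin n → U)) :=
  {C | ∀ φ : (expLang L n).Sentence, HoldsIn C φ ↔ HoldsIn D φ}

/-- `Aut(U/A)`: the automorphisms of `U` that fix `A` pointwise. -/
def autOver (A : Set U) : Set (U ≃[L] U) := {f | ∀ a ∈ A, f a = a}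

/-- `o(b/A)`: the orbit of the tuple `b` under `Aut(U/A)`. -/
def tupleOrbit {n : ℕ} (A : Set U) (b : Fin n → U) : Set (Fin n → U) :=
  {c | ∃ f ∈ autOver L A, c = f ∘ b}

/-- `o(D/A)`: the orbit of the set `D` under `Aut(U/A)`. -/
def setOrbit {n : ℕ} (A : Set U) (D : Set (Fin n → U)) : Set (Set (Fin n → U)) :=
  {C | ∃ f ∈ autOver L A, C = (fun x => f ∘ x) '' D}

/-- `D` is invariant over `A`. -/
def IsInvariant {n : ℕ} (A : Set U) (D : Set (Fin n → U)) : Prop :=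
  setOrbit L A D = {D}

/-- `D` is Lascar invariant over `A`: invariant over every (small) model containing `A`. -/
def IsLascarInvariant {n : ℕ} (A : Set U) (D : Set (Fin n → U)) : Prop :=
  ∀ M : L.ElementarySubstructure U, A ⊆ (M : Set U) → #M < #U → IsInvariant L (M : Set U) D

/-- `u` locally covers `B`: every `K ⊆ B` of the cardinality of `U` meets, for each `k`,
some member of `u` in at least `k` points. -/
def LocallyCovers {n : ℕ} (u : Set (Set (Fin n → U))) (B : Set (Fin n → U)) : Prop :=
  ∀ K ⊆ B, #K = #U → ∀ k : ℕ, ∃ C ∈ u, (k : ℕ∞) ≤ (K ∩ C).encard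

/-- `D` is pseudo-invariant over `A`. -/
def IsPseudoInvariant {n : ℕ} (A : Set U) (D : Set (Fin n → U)) : Prop :=
  ∀ b ∈ D, LocallyCovers (eqClass L D) (tupleOrbit L A b)

variable (U)

/-- `U` is a saturated `L`-structure: every finitely satisfiable set of formulas in one variable
with parameters in a set of cardinality less than that of `U` is realized in `U`. -/
def IsSaturatedModel : Prop :=
  ∀ A : Set U, #A < #U → ∀ p : Set (L[[A]].Formula (Fin 1)),
    (∀ s : Finset (L[[A]].Formula (Fin 1)), (s : Set (L[[A]].Formula (Fin 1))) ⊆ p →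
      ∃ x : Fin 1 → U, ∀ φ ∈ s, φ.Realize x) →
    ∃ x : Fin 1 → U, ∀ φ ∈ p, φ.Realize x

end LascarPseudo

/-!
A Lascar invariant set `E` is itself pseudo-invariant, and the sets definable over `A` from a Lascar
invariant `D` are Lascar invariant. For the former, let `b ∈ E`, let `K ⊆ o(b/A)` have the
cardinality of `U`, and fix a small model `M ⊇ A`. As there are few types over `M`, infinitely many
elements of `K` have the same type over `M`; let `f ∘ b` be one of them, with `f` in `Aut(U/A)`. The
set `f[E]` lies in `e(E)` and is again Lascar invariant over `A`, so it is invariant over `M`, and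
by homogeneity it contains every tuple that has the type of `f ∘ b` over `M`.
-/

universe u' w'

namespace LascarPseudo

section FiniteCharacter

theorem union_image_mem_of_isOfFiniteCharacter {ι : Type u'} {α : Type w'} [LinearOrder ι]
    {P : Set (Set α)} (hP : Order.IsOfFiniteCharacter P) {F : Set α} (hF : F ∈ P) {c : ι → α}
    {I : Set ι} (hI : ∀ i ∈ I, F ∪ c '' Set.Iic i ∈ P) : F ∪ c '' I ∈ P := by
  refine (hP _).2 fun s hs hsfin => ?_
  obtain ⟨t, htI, htfin, hst⟩ : ∃ t ⊆ I, t.Finite ∧ s \ F ⊆ c '' t :=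
    Set.exists_subset_image_finite_and.1
      ⟨s \ F, Set.sdiff_subset_iff.2 hs, hsfin.subset Set.sdiff_subset, subset_rfl⟩
  rw [Set.sdiff_subset_iff] at hst
  rcases t.eq_empty_or_nonempty with rfl | htne
  · exact (hP F).1 hF s (by simpa using hst) hsfin
  · obtain ⟨i, hit, himax⟩ := htfin.exists_maximal htne
    have hti : t ⊆ Set.Iic i := fun j hj => (le_total j i).elim id (himax hj)
    have hsi : s ⊆ F ∪ c '' Set.Iic i :=
      hst.trans (Set.union_subset_union_right F (Set.image_mono hti))
    exact (hP _).1 (hI i (htI hit)) s hsi hsfin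

theorem exists_forall_eq_apply_image_Iio {ι : Type u'} {α : Type w'} [LinearOrder ι]
    [WellFoundedLT ι] (q : Set α → ι → α) : ∃ c : ι → α, ∀ i, c i = q (c '' Set.Iio i) i := by
  refine ⟨WellFoundedLT.fix fun i c => q (Set.range fun j : Set.Iio i => c j j.2) i, fun i => ?_⟩
  rw [WellFoundedLT.fix_eq, Set.image_eq_range]

theorem exists_superset_inter_nonempty_of_isOfFiniteCharacter {ι α : Type w} [Infinite ι]
    {P : Set (Set α)} (hP : Order.IsOfFiniteCharacter P) (R : ι → Set α)
    (hext : ∀ G ∈ P, #G < #ι → ∀ i, ∃ a ∈ R i, insert a G ∈ P) {F : Set α} (hF : F ∈ P)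
    (hFι : #F < #ι) : ∃ G ∈ P, F ⊆ G ∧ ∀ i, (G ∩ R i).Nonempty := by
  obtain ⟨_, _, hord⟩ := exists_ord_eq_type_lt ι
  have : Nonempty α := (hext F hF hFι (Classical.arbitrary ι)).nonempty
  have hext' : ∀ G i, ∃ a, G ∈ P → #G < #ι → a ∈ R i ∧ insert a G ∈ P := fun G i => by
    by_cases h : G ∈ P ∧ #G < #ι
    · exact (hext G h.1 h.2 i).imp fun _ ha _ _ => ha
    · exact ⟨Classical.arbitrary α, fun hG hGι => (h ⟨hG, hGι⟩).elim⟩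
  choose q hq using hext'
  obtain ⟨c, hc⟩ := exists_forall_eq_apply_image_Iio fun s i => q (F ∪ s) i
  have hsmall (i : ι) : #(F ∪ c '' Set.Iio i : Set α) < #ι :=
    (mk_union_le _ _).trans_lt
      (add_lt_of_lt (aleph0_le_mk ι) hFι (mk_image_le.trans_lt (mk_Iio_lt i hord)))
  have hstep (i : ι) (hi : F ∪ c '' Set.Iio i ∈ P) : c i ∈ R i ∧ F ∪ c '' Set.Iic i ∈ P := by
    rw [← Set.Iio_insert, Set.image_insert_eq, Set.union_insert, hc i]
    exact hq _ i hi (hsmall i)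
  have hIic (i : ι) : F ∪ c '' Set.Iic i ∈ P := by
    induction i using WellFoundedLT.induction with
    | ind i ih => exact (hstep i (union_image_mem_of_isOfFiniteCharacter hP hF ih)).2
  refine ⟨F ∪ c '' Set.univ, union_image_mem_of_isOfFiniteCharacter hP hF fun i _ => hIic i,
    Set.subset_union_left, fun i => ⟨c i, .inr ⟨i, trivial, rfl⟩, (hstep i ?_).1⟩⟩
  exact union_image_mem_of_isOfFiniteCharacter hP hF fun j _ => hIic j

end FiniteCharacter

section Types

open FirstOrder.Language

/-- The families `a` and `b`, possibly in different structures, have the same complete type over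
the empty set. Types over a set are obtained by adjoining an enumeration of it to both families. -/
def SameType (L : FirstOrder.Language.{u, v}) {ι : Type u'} {M : Type w} {N : Type w'}
    [L.Structure M] [L.Structure N] (a : ι → M) (b : ι → N) : Prop :=
  ∀ φ : L.Formula ι, φ.Realize a ↔ φ.Realize b

variable {L : FirstOrder.Language.{u, v}} {ι : Type u'}

namespace SameType

variable {M : Type w} {N : Type w'} [L.Structure M] [L.Structure N] {a : ι → M} {b : ι → N}

theorem symm (h : SameType L a b) : SameType L b a :=
  fun φ => (h φ).symm

theorem comp {κ : Type*} (h : SameType L a b) (g : κ → ι) : SameType L (a ∘ g) (b ∘ g) :=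
  fun φ => by simpa only [Formula.realize_relabel] using h (φ.relabel g)

theorem eq_iff (h : SameType L a b) (i j : ι) : a i = a j ↔ b i = b j := by
  simpa using h (Term.equal (Term.var i) (Term.var j))

theorem of_forall_finset
    (h : ∀ s : Finset ι, SameType L (fun i : s => a i) (fun i : s => b i)) : SameType L a b := by
  classical
  intro φ
  have hφ := h φ.freeVarFinset (φ.restrictFreeVar id)
  exact (BoundedFormula.realize_restrictFreeVar (f := id) a fun _ => rfl).symm.trans
    (hφ.trans (BoundedFormula.realize_restrictFreeVar (f := id) b fun _ => rfl))

theorem exists_equiv_of_surjective (h : SameType L a b) (ha : Function.Surjective a)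
    (hb : Function.Surjective b) : ∃ e : M ≃[L] N, ∀ i, e (a i) = b i := by
  choose s hs using ha
  choose t ht using hb
  have hba (i : ι) : b (s (a i)) = b i := (h.eq_iff _ _).1 (hs _)
  have hab (i : ι) : a (t (b i)) = a i := (h.eq_iff _ _).2 (ht _)
  refine ⟨⟨⟨fun x => b (s x), fun y => a (t y), fun x => (hab _).trans (hs x),
    fun y => (hba _).trans (ht y)⟩, fun f x => ?_, fun r x => ?_⟩, hba⟩
  · have hf := h (Term.equal (Term.func f fun k => Term.var (s (x k)))
      (Term.var (s (Structure.funMap f x))))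
    simp only [Formula.realize_equal, Term.realize_func, Term.realize_var, hs, true_iff] at hf
    exact hf.symm
  · have hr := h (r.formula fun k => Term.var (s (x k)))
    simp only [Formula.realize_rel, Term.realize_var, hs] at hr
    exact hr.symm

end SameType

variable {M N : Type w} [L.Structure M] [L.Structure N]

theorem exists_formula_constants_realize_iff (b : ι → N) (φ : L.Formula (ι ⊕ Fin 1)) :
    ∃ ψ : L[[Set.range b]].Formula (Fin 1), ∀ z, ψ.Realize z ↔ φ.Realize (Sum.elim b z) := by
  refine ⟨BoundedFormula.constantsVarsEquiv.symm
    (φ.relabel (Sum.map (Set.rangeFactorization b) id)), fun z => ?_⟩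
  rw [Formula.Realize, ← BoundedFormula.realize_constantsVarsEquiv, Equiv.apply_symm_apply]
  change Formula.Realize _ _ ↔ _
  rw [Formula.realize_relabel, Sum.elim_comp_map]
  rfl

theorem IsSaturatedModel.exists_forall_realize_sumElim (hN : IsSaturatedModel L N) {b : ι → N}
    (hb : #(Set.range b) < #N) {p : Set (L.Formula (ι ⊕ Fin 1))}
    (hp : ∀ s : Finset (L.Formula (ι ⊕ Fin 1)), (s : Set (L.Formula (ι ⊕ Fin 1))) ⊆ p →
      ∃ z, ∀ φ ∈ s, φ.Realize (Sum.elim b z)) :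
    ∃ z, ∀ φ ∈ p, φ.Realize (Sum.elim b z) := by
  classical
  choose ψ hψ using exists_formula_constants_realize_iff (L := L) b
  obtain ⟨z, hz⟩ := hN (Set.range b) hb (ψ '' p) fun s hs => by
    obtain ⟨t, htp, rfl⟩ := Finset.subset_set_image_iff.1 hs
    simpa only [Finset.forall_mem_image, hψ] using hp t htp
  exact ⟨z, fun φ hφ => (hψ φ z).1 (hz _ ⟨φ, hφ, rfl⟩)⟩

theorem SameType.exists_extend (hN : IsSaturatedModel L N) {a : ι → M} {b : ι → N}
    (h : SameType L a b) (hb : #(Set.range b) < #N) (x : Fin 1 → M) :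
    ∃ y, SameType L (Sum.elim a x) (Sum.elim b y) := by
  obtain ⟨y, hy⟩ := hN.exists_forall_realize_sumElim hb
    (p := {φ : L.Formula (ι ⊕ Fin 1) | φ.Realize (Sum.elim a x)}) fun s hs => by
      have ha : ((Formula.iInf fun φ : s => φ.1).iExs (Fin 1)).Realize a :=
        Formula.realize_iExs.2 ⟨x, Formula.realize_iInf.2 fun φ => hs φ.2⟩
      obtain ⟨y, hy⟩ := Formula.realize_iExs.1 ((h _).1 ha)
      exact ⟨y, fun φ hφ => Formula.realize_iInf.1 hy ⟨φ, hφ⟩⟩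
  refine ⟨y, fun φ => ⟨hy φ, fun hφ => ?_⟩⟩
  by_contra hn
  exact Formula.realize_not.1 (hy φ.not (Formula.realize_not.2 hn)) hφ

end Types

section BackAndForth

/-- `F` is the graph of a partial elementary map from `M` to `N`: its two coordinate projections,
as families indexed by `F`, have the same type. Graphs make extension of maps set inclusion. -/
def IsPartialElementary (L : FirstOrder.Language.{u, v}) {M : Type w} {N : Type w'}
    [L.Structure M] [L.Structure N] (F : Set (M × N)) : Prop :=
  SameType L (fun p : F => p.1.1) (fun p : F => p.1.2)

variable {L : FirstOrder.Language.{u, v}} {M N : Type w} [L.Structure M] [L.Structure N]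
  {F G : Set (M × N)}

theorem IsPartialElementary.mono (hG : IsPartialElementary L G) (hFG : F ⊆ G) :
    IsPartialElementary L F :=
  SameType.comp hG (Set.inclusion hFG)

theorem SameType.isPartialElementary_range {ι : Type u'} {a : ι → M} {b : ι → N}
    (h : SameType L a b) : IsPartialElementary L (Set.range fun i => (a i, b i)) := by
  choose g hg using fun p : Set.range fun i => (a i, b i) => p.2
  have ha : a ∘ g = fun p => p.1.1 := funext fun p => congrArg Prod.fst (hg p)
  have hb : b ∘ g = fun p => p.1.2 := funext fun p => congrArg Prod.snd (hg p)
  simpa only [IsPartialElementary, ha, hb] using h.comp g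

theorem isOfFiniteCharacter_isPartialElementary :
    Order.IsOfFiniteCharacter {F : Set (M × N) | IsPartialElementary L F} := by
  classical
  refine fun F => ⟨fun hF s hs _ => hF.mono hs, fun h => SameType.of_forall_finset fun s => ?_⟩
  have hs : IsPartialElementary L (s.image Subtype.val : Set (M × N)) :=
    h _ (by simp) (Finset.finite_toSet _)
  exact SameType.comp hs fun i : s => ⟨i.1.1, Finset.mem_image_of_mem _ i.2⟩

namespace IsPartialElementary

theorem swap (hF : IsPartialElementary L F) : IsPartialElementary L (Prod.swap '' F) := by
  rw [Set.image_eq_range]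
  exact (SameType.symm hF).isPartialElementary_range

theorem exists_forth (hN : IsSaturatedModel L N) (hF : IsPartialElementary L F) (hFN : #F < #N)
    (x : M) : ∃ y, IsPartialElementary L (insert (x, y) F) := by
  obtain ⟨y, hy⟩ := SameType.exists_extend hN hF (mk_range_le.trans_lt hFN) fun _ => x
  refine ⟨y 0, hy.isPartialElementary_range.mono ?_⟩
  rintro p (rfl | hp)
  · exact ⟨Sum.inr 0, rfl⟩
  · exact ⟨Sum.inl ⟨p, hp⟩, rfl⟩

theorem exists_back (hM : IsSaturatedModel L M) (hF : IsPartialElementary L F) (hFM : #F < #M)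
    (y : N) : ∃ x, IsPartialElementary L (insert (x, y) F) := by
  obtain ⟨x, hx⟩ := hF.swap.exists_forth hM (mk_image_le.trans_lt hFM) y
  exact ⟨x, by simpa only [Set.image_insert_eq, Set.image_image, Prod.swap_swap, Prod.swap_prod_mk,
    Set.image_id'] using hx.swap⟩

theorem exists_equiv_of_isSaturatedModel [Infinite M] (hM : IsSaturatedModel L M)
    (hN : IsSaturatedModel L N) (hMN : #M = #N) (hF : IsPartialElementary L F) (hFM : #F < #M) :
    ∃ e : M ≃[L] N, ∀ p ∈ F, e p.1 = p.2 := by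
  have hsum : #(M ⊕ N) = #M := by
    rw [mk_sum, lift_id, lift_id, ← hMN, add_eq_self (aleph0_le_mk M)]
  obtain ⟨G, hG, hFG, hmeets⟩ := exists_superset_inter_nonempty_of_isOfFiniteCharacter
    (isOfFiniteCharacter_isPartialElementary (L := L))
    (Sum.elim (fun x : M => {p | p.1 = x}) fun y : N => {p | p.2 = y})
    (fun H hH hcard i => by
      rw [hsum] at hcard
      rcases i with x | y
      · exact (hH.exists_forth hN (hMN ▸ hcard) x).elim fun y hy => ⟨(x, y), rfl, hy⟩
      · exact (hH.exists_back hM hcard y).elim fun x hx => ⟨(x, y), rfl, hx⟩)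
    hF (hsum.symm ▸ hFM)
  obtain ⟨e, he⟩ := SameType.exists_equiv_of_surjective hG
    (fun x => (hmeets (.inl x)).elim fun p hp => ⟨⟨p, hp.1⟩, hp.2⟩)
    (fun y => (hmeets (.inr y)).elim fun p hp => ⟨⟨p, hp.1⟩, hp.2⟩)
  exact ⟨e, fun p hp => he ⟨p, hFG hp⟩⟩

end IsPartialElementary

end BackAndForth

section StrongHomogeneity

/-- `U` is strongly homogeneous: every partial elementary map of cardinality less than that of `U`
extends to an automorphism of `U`. -/
def IsStronglyHomogeneous (L : FirstOrder.Language.{u, v}) (U : Type w) [L.Structure U] : Prop :=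
  ∀ F : Set (U × U), IsPartialElementary L F → #F < #U → ∃ e : U ≃[L] U, ∀ p ∈ F, e p.1 = p.2

variable {L : FirstOrder.Language.{u, v}} {U : Type w} [L.Structure U]

theorem IsSaturatedModel.isStronglyHomogeneous [Infinite U] (hU : IsSaturatedModel L U) :
    IsStronglyHomogeneous L U :=
  fun _ hF hFU => hF.exists_equiv_of_isSaturatedModel hU hU rfl hFU

theorem IsStronglyHomogeneous.exists_equiv_of_sameType (hU : IsStronglyHomogeneous L U)
    {ι : Type w} (hι : #ι < #U) {a b : ι → U} (h : SameType L a b) :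
    ∃ e : U ≃[L] U, ∀ i, e (a i) = b i :=
  (hU _ h.isPartialElementary_range (mk_range_le.trans_lt hι)).imp fun _ he i => he _ ⟨i, rfl⟩

end StrongHomogeneity

section Counting

open FirstOrder.Language

variable {L : FirstOrder.Language.{u, v}} {μ : Cardinal.{w}}

theorem mk_formula_le_lift {ι : Type w} (hμ : ℵ₀ ≤ μ)
    (hL : Cardinal.lift.{w} L.card ≤ Cardinal.lift.{max u v} μ) (hι : #ι ≤ μ) :
    #(L.Formula ι) ≤ Cardinal.lift.{max u v} μ :=
  calc #(L.Formula ι) ≤ #(Σ k, L.BoundedFormula ι k) :=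
        mk_le_of_injective (sigma_mk_injective (i := 0))
    _ ≤ max ℵ₀ (Cardinal.lift.{max u v} #ι + Cardinal.lift.{w} L.card) := BoundedFormula.card_le
    _ ≤ Cardinal.lift.{max u v} μ :=
        have hμ' := aleph0_le_lift.2 hμ
        max_le hμ' (add_le_of_le hμ' (Cardinal.lift_le.2 hι) hL)

theorem exists_infinite_pairwise_sameType {ι X : Type w} {M : Type w'} [L.Structure M]
    (hμ : ℵ₀ ≤ μ) (hL : Cardinal.lift.{w} L.card ≤ Cardinal.lift.{max u v} μ) (hι : #ι ≤ μ)
    (hX : 2 ^ μ < #X) (a : X → ι → M) :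
    ∃ T : Set X, T.Infinite ∧ ∀ x ∈ T, ∀ y ∈ T, SameType L (a x) (a y) := by
  let typeOf : X → Set (L.Formula ι) := fun x => {φ | φ.Realize (a x)}
  have htypes : Cardinal.lift.{max u v} #(Quotient (Setoid.ker typeOf)) ≤
      Cardinal.lift.{max u v} (2 ^ μ) := by
    rw [lift_two_power]
    calc Cardinal.lift.{max u v} #(Quotient (Setoid.ker typeOf)) ≤ #(Set (L.Formula ι)) := by
          rw [← mk_uLift]
          exact mk_le_of_injective ((Setoid.kerLift_injective typeOf).comp ULift.down_injective)
      _ = 2 ^ #(L.Formula ι) := mk_set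
      _ ≤ 2 ^ Cardinal.lift.{max u v} μ :=
          power_le_power_left two_ne_zero (mk_formula_le_lift hμ hL hι)
  have : Infinite X := infinite_iff.2 (hμ.trans ((cantor μ).le.trans hX.le))
  obtain ⟨t, ht⟩ := exists_infinite_fiber (Quotient.mk (Setoid.ker typeOf))
    ((Cardinal.lift_le.1 htypes).trans_lt hX)
  refine ⟨_, Set.infinite_coe_iff.1 ht, fun x hx y hy φ => ?_⟩
  exact Set.ext_iff.1 (Quotient.exact (hx.trans hy.symm) : typeOf x = typeOf y) φ

theorem exists_elementarySubstructure_superset_mk_eq {M : Type w} [L.Structure M] (hμ : ℵ₀ ≤ μ)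
    (hL : Cardinal.lift.{w} L.card ≤ Cardinal.lift.{max u v} μ) (hM : μ ≤ #M) {A : Set M}
    (hA : #A ≤ μ) : ∃ S : L.ElementarySubstructure M, A ⊆ S ∧ #S = μ := by
  obtain ⟨S, hAS, hS⟩ := exists_elementarySubstructure_card_eq L A μ hμ (Cardinal.lift_le.2 hA) hL
    (Cardinal.lift_le.2 hM)
  exact ⟨S, hAS, Cardinal.lift_injective hS⟩

end Counting

section Automorphisms

open FirstOrder.Language

variable {L : FirstOrder.Language.{u, v}}

theorem exists_elementarySubstructure_coe_eq_range {M : Type w} {N : Type w'} [L.Structure M]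
    [L.Structure N] (f : M ↪ₑ[L] N) :
    ∃ S : L.ElementarySubstructure N, (S : Set N) = Set.range f := by
  let e := f.toEmbedding.equivRange
  refine ⟨⟨f.toEmbedding.toHom.range, fun k φ x => ?_⟩, Hom.range_coe _⟩
  obtain ⟨y, rfl⟩ : ∃ y, x = e ∘ y := ⟨e.symm ∘ x, funext fun i => (e.apply_symm_apply _).symm⟩
  exact (f.map_formula φ y).trans (StrongHomClass.realize_formula e φ).symm

theorem realize_expLang_image_iff {M : Type w} {N : Type w'} [L.Structure M] [L.Structure N]
    (f : M ≃[L] N) {n : ℕ} (D : Set (Fin n → M)) {ι : Type u'} (φ : (expLang L n).Formula ι)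
    (x : ι → M) :
    (letI := predStructure ((f ∘ ·) '' D); φ.Realize (f ∘ x)) ↔
      (letI := predStructure D; φ.Realize x) := by
  let _ := predStructure D
  let _ := predStructure ((f ∘ ·) '' D)
  let g : M ≃[expLang L n] N :=
    { f.toEquiv with
      map_fun' := by
        rintro k (h | h) y
        · exact f.map_fun h y
        · exact h.elim
      map_rel' := by
        rintro k (r | r) y
        · exact f.map_rel r y
        · cases r
          exact (Function.Injective.comp_left (α := Fin n) f.injective).mem_set_image }
  exact StrongHomClass.realize_formula g φ

variable {U : Type w} [L.Structure U] {n m : ℕ} {A : Set U} {D : Set (Fin n → U)} {f : U ≃[L] U}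

theorem image_mem_eqClass (f : U ≃[L] U) (D : Set (Fin n → U)) : (f ∘ ·) '' D ∈ eqClass L D :=
  fun φ => by
    have h := realize_expLang_image_iff f D φ default
    rwa [Unique.eq_default (f ∘ default)] at h

theorem solutionSet_image (hf : f ∈ autOver L A) (φ : (expLang L n)[[A]].Formula (Fin m)) :
    solutionSet ((f ∘ ·) '' D) φ = (f ∘ ·) '' solutionSet D φ := by
  ext y
  obtain ⟨x, rfl⟩ := f.surjective.comp_left y
  rw [f.injective.comp_left.mem_set_image]
  have h := realize_expLang_image_iff f D (BoundedFormula.constantsVarsEquiv φ)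
    (Sum.elim (fun a : A => (a : U)) x)
  rw [Sum.comp_elim, show f ∘ (fun a : A => (a : U)) = fun a : A => (a : U) from
    funext fun a => hf a a.2] at h
  have hconst (E : Set (Fin n → U)) (z : Fin m → U) :=
    letI := predStructure E
    BoundedFormula.realize_constantsVarsEquiv (M := U) (φ := φ) (v := z) (xs := default)
  exact (hconst _ _).symm.trans (h.trans (hconst _ _))

theorem isInvariant_iff_forall_image_eq :
    IsInvariant L A D ↔ ∀ f ∈ autOver L A, (f ∘ ·) '' D = D := by
  refine ⟨fun h f hf => h.subset ⟨f, hf, rfl⟩, fun h => Set.Subset.antisymm ?_ ?_⟩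
  · rintro _ ⟨f, hf, rfl⟩
    exact h f hf
  · rintro _ rfl
    exact ⟨FirstOrder.Language.Equiv.refl L U, fun _ _ => rfl, (Set.image_id _).symm⟩

namespace IsLascarInvariant

theorem solutionSet (hD : IsLascarInvariant L A D) (φ : (expLang L n)[[A]].Formula (Fin m)) :
    IsLascarInvariant L A (solutionSet D φ) := by
  refine fun M hAM hMU => isInvariant_iff_forall_image_eq.2 fun f hf => ?_
  rw [← solutionSet_image fun a ha => hf a (hAM ha),
    isInvariant_iff_forall_image_eq.1 (hD M hAM hMU) f hf]

theorem image (hD : IsLascarInvariant L A D) (hf : f ∈ autOver L A) :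
    IsLascarInvariant L A ((f ∘ ·) '' D) := by
  refine fun M hAM hMU => isInvariant_iff_forall_image_eq.2 fun g hg => ?_
  obtain ⟨N, hN⟩ := exists_elementarySubstructure_coe_eq_range
    (f.symm.toElementaryEmbedding.comp M.subtype)
  have hAN : A ⊆ N := fun a ha =>
    hN ▸ ⟨⟨a, hAM ha⟩, (f.symm_apply_eq).2 (hf a ha).symm⟩
  have hNU : #(N : Set U) < #U := by
    rw [hN]
    exact mk_range_le.trans_lt hMU
  -- The conjugate of `g` by `f` fixes `N = f⁻¹[M]` pointwise.
  have hconj : f.symm.comp (g.comp f) ∈ autOver L (N : Set U) := fun a ha => by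
    obtain ⟨c, rfl⟩ : a ∈ Set.range _ := hN ▸ ha
    change f.symm (g (f (f.symm c))) = f.symm c
    rw [f.apply_symm_apply, hg c c.2]
  calc (g ∘ ·) '' ((f ∘ ·) '' D) = (f ∘ ·) '' ((f.symm.comp (g.comp f) ∘ ·) '' D) := by
        simp only [Set.image_image]
        exact Set.image_congr fun x _ => funext fun i => (f.apply_symm_apply _).symm
    _ = (f ∘ ·) '' D := by rw [isInvariant_iff_forall_image_eq.1 (hD N hAN hNU) _ hconj]

theorem isPseudoInvariant (hU : IsStronglyHomogeneous L U) {μ : Cardinal.{w}} (hμ : ℵ₀ ≤ μ)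
    (hL : Cardinal.lift.{w} L.card ≤ Cardinal.lift.{max u v} μ) (hA : #A ≤ μ) (hμU : 2 ^ μ < #U)
    (hD : IsLascarInvariant L A D) : IsPseudoInvariant L A D := by
  intro b hb K hKb hK k
  have hμ_lt : μ < #U := (cantor μ).trans hμU
  obtain ⟨M, hAM, hM⟩ := exists_elementarySubstructure_superset_mk_eq hμ hL hμ_lt.le hA
  have hι : #(M ⊕ Fin n) ≤ μ := by
    simpa [hM] using add_le_of_le hμ le_rfl (natCast_lt_aleph0.le.trans hμ)
  obtain ⟨T, hTinf, hT⟩ := exists_infinite_pairwise_sameType hμ hL hι (hK ▸ hμU)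
    fun x : K => Sum.elim (fun a : M => (a : U)) x.1
  obtain ⟨⟨x₀, hx₀K⟩, hx₀T⟩ := hTinf.nonempty
  obtain ⟨f, hf, rfl⟩ := hKb hx₀K
  have hTC : Subtype.val '' T ⊆ K ∩ (f ∘ ·) '' D := by
    rintro _ ⟨x, hx, rfl⟩
    obtain ⟨g, hg⟩ := hU.exists_equiv_of_sameType (hι.trans_lt hμ_lt) (hT _ hx₀T _ hx)
    have hgx : g ∘ f ∘ b = x := funext fun i => hg (.inr i)
    have hgM : g ∈ autOver L (M : Set U) := fun a ha => hg (.inl ⟨a, ha⟩)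
    refine ⟨x.2, ?_⟩
    rw [← isInvariant_iff_forall_image_eq.1 (hD.image hf M hAM (hM.trans_lt hμ_lt)) g hgM, ← hgx]
    exact Set.mem_image_of_mem _ (Set.mem_image_of_mem _ hb)
  refine ⟨_, image_mem_eqClass f D, ?_⟩
  rw [((hTinf.image Subtype.val_injective.injOn).mono hTC).encard_eq]
  exact le_top

end IsLascarInvariant

end Automorphisms

theorem exists_two_power_lt_of_isStrongLimit {κ α : Cardinal.{w}} {β : Cardinal.{u'}}
    (hκ : κ.IsStrongLimit) (hκ₀ : ℵ₀ < κ) (hα : α < κ)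
    (hβ : Cardinal.lift.{w} β < Cardinal.lift.{u'} κ) :
    ∃ μ, ℵ₀ ≤ μ ∧ α ≤ μ ∧ Cardinal.lift.{w} β ≤ Cardinal.lift.{u'} μ ∧ 2 ^ μ < κ := by
  obtain ⟨β', hβ'⟩ := mem_range_lift_of_le hβ.le
  rw [← hβ', Cardinal.lift_lt] at hβ
  exact ⟨max ℵ₀ (max α β'), le_max_left _ _, (le_max_left _ _).trans (le_max_right _ _),
    hβ' ▸ Cardinal.lift_le.2 ((le_max_right _ _).trans (le_max_right _ _)),
    hκ.isStrongPrelimit (max_lt hκ₀ (max_lt hα hβ))⟩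

end LascarPseudo

open LascarPseudo in
theorem mainTheorem8_general (L : FirstOrder.Language.{u, v}) (U : Type w) [L.Structure U]
    (hU : IsStronglyHomogeneous L U) (μ : Cardinal.{w}) (hμ : ℵ₀ ≤ μ) (hμU : 2 ^ μ < #U)
    (hL : Cardinal.lift.{w} L.card ≤ Cardinal.lift.{max u v} μ)
    (n : ℕ) (D : Set (Fin n → U)) (A : Set U) (hA : #A ≤ μ) (hD : IsLascarInvariant L A D)
    (m : ℕ) (φ : (expLang L n)[[A]].Formula (Fin m)) :
    IsPseudoInvariant L A (solutionSet D φ) :=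
  (hD.solutionSet φ).isPseudoInvariant hU hμ hL hA hμU

theorem mainTheorem8 (L : FirstOrder.Language.{u, v}) (U : Type w) [L.Structure U]
    (hsat : LascarPseudo.IsSaturatedModel L U)
    (hκ : (#U).IsInaccessible)
    (hL : Cardinal.lift.{w} L.card < Cardinal.lift.{max u v} #U)
    (n : ℕ) (D : Set (Fin n → U)) (A : Set U) (hA : #A < #U)
    (hD : LascarPseudo.IsLascarInvariant L A D)
    (m : ℕ) (φ : (LascarPseudo.expLang L n)[[A]].Formula (Fin m)) :
    LascarPseudo.IsPseudoInvariant L A (LascarPseudo.solutionSet D φ) := by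
  have : Infinite U := infinite_iff.2 hκ.aleph0_lt.le
  obtain ⟨μ, hμ, hAμ, hLμ, hμU⟩ :=
    LascarPseudo.exists_two_power_lt_of_isStrongLimit hκ.isStrongLimit hκ.aleph0_lt hA hL
  exact mainTheorem8_general L U hsat.isStronglyHomogeneous μ hμ hμU hLμ n D A hAμ hD m φ
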